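/- Conventions. An MV-algebra is a structure $(A,\oplus,0,1,\neg)$ such that $(A,\oplus,0)$ is a commutative monoid, $\neg 0=1$, $x\oplus 1=1$, $\neg\neg x=x$ and $\neg(\neg x\oplus y)\oplus y=\neg(\neg y\oplus x)\oplus x$. It is a lattice for the order in which $x\le y$ if and only if $y=x\oplus z$ for some $z$. Put $x\odot y=\neg(\neg x\oplus\neg y)$, $x^2=x\odot x$, $2x=x\oplus x$ and, in general, $nx=x\oplus\dots\oplus x$ ($n$ times). The radical $\mathrm{Rad}(A)$ is the set of all $x\in A$ with $nx\le\neg x$ for every positive integer $n$. A perfect MV-algebra is an MV-algebra with $0\neq1$ that is generated, as an MV-algebra, by its radical. Let $\mathrm{PERF}$ be the category of perfect MV-algebras and MV-algebra homomorphisms, and let $\ell\mathcal G$ be the category of abelian lattice-ordered groups ($\ell$-groups) and $\ell$-group homomorphisms. Let $\Delta:\ell\mathcal G\to\mathrm{PERF}$ be the functor sending $G$ to the interval $[(0,0),(1,0)]$ of the lexicographic product $\mathbb Z\times_{\mathrm{lex}}G$, with $x\oplus y=(x+y)\wedge(1,0)$ and $\neg x=(1,0)-x$, and sending $f:G\to H$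 to the map $(n,g)\mapsto(n,f(g))$. Let $\mathrm{TOP}$ be the following category. Its objects are the structures $(S,+,0,\wedge,\vee,\top)$ isomorphic to $G^+\cup\{\top\}$ for some abelian $\ell$-group $G$, where $G^+=\{g\in G: g\ge 0\}$ is the positive cone and $\top$ is a new element with $x\le\top$ and $x+\top=\top$ for all $x$. Its morphisms are the maps preserving $+,0,\wedge,\vee$ and $\top$ that send the positive cone $S\setminus\{\top\}$ of the source into the positive cone of the target. For an MV-algebra $A$ let $\theta(A)=\{x\in A: x\ge 2x^2\}$. For a perfect MV-algebra $P$ regard $\theta(P)$ as a structure with the operations $\oplus,0,\wedge,\vee$ of $P$ and top $1$; for a homomorphism $h:P\to Q$ of perfect MV-algebras let $\theta(h):\theta(P)\to\theta(Q)$ be the restriction of $h$. Theorem. For every perfect MV-algebra $P$ one has $\theta(P)=\mathrm{Rad}(P)\cup\{1\}$, and $\theta(P)$ is an object of $\mathrm{TOP}$. The functor $\theta:\mathrm{PERF}\to\mathrm{TOP}$ is an equivalence of categories, and $\theta\circ\Delta:\ell\mathcal G\to\mathrm{TOP}$ is an equivalence of categories. -/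

import Mathlib

open CategoryTheory

universe u

/-! ### MV-algebras -/

/-- An MV-algebra. The operation `⊕` is written `+` (so that the multiple `nx` is `n • x`), and the
negation `¬ x` is written `xᶜ`. -/
class MVAlgebra (A : Type u) extends AddCommMonoid A, One A, Compl A where
  mv_compl_zero : (0 : A)ᶜ = 1
  mv_add_one : ∀ x : A, x + 1 = 1
  mv_compl_compl : ∀ x : A, xᶜᶜ = x
  mv_lukasiewicz : ∀ x y : A, (xᶜ + y)ᶜ + y = (yᶜ + x)ᶜ + x

namespace MVAlgebra

section Basic

variable {A : Type u} [MVAlgebra A]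

/-- `x ⊙ y = ¬(¬ x ⊕ ¬ y)`. -/
def odot (x y : A) : A := (xᶜ + yᶜ)ᶜ

theorem mv_compl_one : (1 : A)ᶜ = 0 := by
  rw [← mv_compl_zero, mv_compl_compl]

theorem mv_compl_add_self (x : A) : xᶜ + x = 1 := by
  have h := mv_lukasiewicz x 1
  rw [mv_add_one, mv_compl_one, zero_add] at h
  exact h.symm

theorem mv_exists_iff (x y : A) : (∃ z, y = x + z) ↔ xᶜ + y = 1 := by
  constructor
  · rintro ⟨z, rfl⟩
    rw [← add_assoc, mv_compl_add_self, add_comm, mv_add_one]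
  · intro h
    refine ⟨(yᶜ + x)ᶜ, ?_⟩
    have h2 := mv_lukasiewicz x y
    rw [h, mv_compl_one, zero_add] at h2
    rw [add_comm]
    exact h2

/-- The natural order: `x ≤ y` if and only if `y = x ⊕ z` for some `z`. -/
instance (priority := 50) instPartialOrder : PartialOrder A where
  le x y := ∃ z, y = x + z
  le_refl x := ⟨0, (add_zero x).symm⟩
  le_trans x y z := by
    rintro ⟨a, rfl⟩ ⟨b, rfl⟩
    exact ⟨a + b, add_assoc _ _ _⟩
  le_antisymm x y h1 h2 := by
    have h1' := (mv_exists_iff x y).1 h1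
    have h2' := (mv_exists_iff y x).1 h2
    have h := mv_lukasiewicz x y
    rw [h1', h2', mv_compl_one, zero_add, zero_add] at h
    exact h.symm

theorem mv_le_def {x y : A} : x ≤ y ↔ ∃ z, y = x + z := Iff.rfl

theorem mv_le_iff {x y : A} : x ≤ y ↔ xᶜ + y = 1 := mv_exists_iff x y

theorem mv_le_add_right (x y : A) : x ≤ x + y := ⟨y, rfl⟩

theorem mv_le_add_left (x y : A) : x ≤ y + x := ⟨y, add_comm _ _⟩

theorem mv_add_le_add {x y z w : A} (h : x ≤ y) (h2 : z ≤ w) : x + z ≤ y + w := by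
  obtain ⟨a, rfl⟩ := h
  obtain ⟨b, rfl⟩ := h2
  exact ⟨a + b, add_add_add_comm _ _ _ _⟩

theorem mv_compl_le_compl {x y : A} (h : x ≤ y) : yᶜ ≤ xᶜ := by
  rw [mv_le_iff] at *
  rw [mv_compl_compl, add_comm, h]

theorem mv_le_compl_comm {x y : A} (h : x ≤ yᶜ) : y ≤ xᶜ := by
  have := mv_compl_le_compl h
  rwa [mv_compl_compl] at this

theorem mv_zero_le (x : A) : 0 ≤ x := ⟨x, (zero_add x).symm⟩

theorem mv_le_one (x : A) : x ≤ 1 := by rw [mv_le_iff, mv_add_one]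

theorem mv_join_eq {x y : A} (h : x ≤ y) : (yᶜ + x)ᶜ + x = y := by
  have h2 := mv_lukasiewicz x y
  rw [mv_le_iff.1 h, mv_compl_one, zero_add] at h2
  exact h2.symm

theorem mv_join_le {x y z : A} (hx : x ≤ z) (hy : y ≤ z) : (xᶜ + y)ᶜ + y ≤ z := by
  have h1 : (xᶜ + y)ᶜ ≤ (zᶜ + y)ᶜ :=
    mv_compl_le_compl (mv_add_le_add (mv_compl_le_compl hx) le_rfl)
  have h2 := mv_add_le_add h1 (le_refl y)
  rwa [mv_join_eq hy] at h2

/-- The lattice operations: `x ∨ y = ¬(¬ x ⊕ y) ⊕ y` and `x ∧ y = ¬(¬ x ∨ ¬ y)`. They are the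
suprema and infima for the natural order. -/
instance (priority := 50) instLattice : Lattice A where
  sup x y := (xᶜ + y)ᶜ + y
  le_sup_left x y := by
    rw [mv_lukasiewicz]
    exact mv_le_add_left _ _
  le_sup_right x y := mv_le_add_left _ _
  sup_le x y z := mv_join_le
  inf x y := ((xᶜᶜ + yᶜ)ᶜ + yᶜ)ᶜ
  inf_le_left x y := by
    have h : xᶜ ≤ (xᶜᶜ + yᶜ)ᶜ + yᶜ := by
      rw [mv_lukasiewicz]
      exact mv_le_add_left _ _
    exact (mv_compl_le_compl h).trans (le_of_eq (mv_compl_compl x))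
  inf_le_right x y := by
    have h2 := mv_compl_le_compl (mv_le_add_left yᶜ (xᶜᶜ + yᶜ)ᶜ)
    rwa [mv_compl_compl y] at h2
  le_inf x y z hy hz :=
    mv_le_compl_comm (mv_join_le (mv_compl_le_compl hy) (mv_compl_le_compl hz))

theorem mv_sup_def (x y : A) : x ⊔ y = (xᶜ + y)ᶜ + y := rfl

theorem mv_inf_def (x y : A) : x ⊓ y = (xᶜ ⊔ yᶜ)ᶜ := rfl

theorem mv_sup_le_add (x y : A) : x ⊔ y ≤ x + y :=
  sup_le (mv_le_add_right _ _) (mv_le_add_left _ _)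

theorem mv_odot_comm (x y : A) : odot x y = odot y x := by
  rw [odot, odot, add_comm]

theorem mv_odot_assoc (x y z : A) : odot (odot x y) z = odot x (odot y z) := by
  simp only [odot, mv_compl_compl, add_assoc]

theorem mv_odot_le_iff {x y z : A} : odot x y ≤ z ↔ x ≤ yᶜ + z := by
  rw [mv_le_iff, mv_le_iff, odot, mv_compl_compl, add_assoc]

theorem mv_odot_mono {x y z w : A} (h : x ≤ y) (h2 : z ≤ w) : odot x z ≤ odot y w :=
  mv_compl_le_compl (mv_add_le_add (mv_compl_le_compl h) (mv_compl_le_compl h2))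

theorem mv_odot_le_right (x y : A) : odot x y ≤ y := by
  rw [mv_odot_le_iff, mv_compl_add_self]
  exact mv_le_one x

theorem mv_odot_le_left (x y : A) : odot x y ≤ x := by
  rw [mv_odot_comm]
  exact mv_odot_le_right y x

theorem mv_le_zero_iff {x : A} : x ≤ 0 ↔ x = 0 :=
  ⟨fun h => le_antisymm h (mv_zero_le x), fun h => h ▸ le_rfl⟩

theorem mv_odot_eq_zero_iff {x y : A} : odot x y = 0 ↔ x ≤ yᶜ := by
  rw [← mv_le_zero_iff, mv_odot_le_iff, add_zero]

theorem mv_odot_compl_add (x y : A) : odot x (xᶜ + y) = x ⊓ y := by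
  rw [inf_comm, mv_inf_def, mv_sup_def, mv_compl_compl, odot, add_comm xᶜ (xᶜ + y)ᶜ, add_comm y]

theorem mv_minus_inf_minus (x y : A) : odot x yᶜ ⊓ odot y xᶜ = 0 := by
  have hd : (odot x yᶜ)ᶜ = xᶜ + y := by simp only [odot, mv_compl_compl]
  generalize he : odot y xᶜ = e
  have h1 : odot x yᶜ ⊓ e = odot (odot e (eᶜ + x)) ((xᶜ + e)ᶜ + yᶜ) := by
    rw [← mv_odot_compl_add, hd, mv_odot_compl_add e x, inf_comm e x, ← mv_odot_compl_add x e,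
      mv_odot_assoc, mv_odot_assoc, mv_odot_compl_add (xᶜ + e) yᶜ, inf_comm (xᶜ + e),
      ← mv_odot_compl_add yᶜ, mv_compl_compl, add_comm xᶜ y, add_assoc]
  rw [h1, ← mv_le_zero_iff]
  have h2 : odot (odot e (eᶜ + x)) ((xᶜ + e)ᶜ + yᶜ) ≤ odot e ((xᶜ + e)ᶜ + yᶜ) :=
    mv_odot_mono (mv_odot_le_left _ _) le_rfl
  refine h2.trans ?_
  have h3 : odot e ((xᶜ + e)ᶜ + yᶜ) = odot xᶜ (y ⊓ (xᶜ + e)ᶜ) := by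
    rw [← mv_odot_compl_add, ← mv_odot_assoc, mv_odot_comm xᶜ y, he, add_comm yᶜ]
  have h4 : (xᶜ + e)ᶜ ≤ x := by
    have := mv_compl_le_compl (mv_le_add_right xᶜ e)
    rwa [mv_compl_compl] at this
  rw [h3]
  have h5 : odot xᶜ (y ⊓ (xᶜ + e)ᶜ) ≤ odot xᶜ x := mv_odot_mono le_rfl (inf_le_right.trans h4)
  refine h5.trans ?_
  rw [mv_le_zero_iff, mv_odot_eq_zero_iff]

theorem mv_prelinear (x y : A) : (xᶜ + y) ⊔ (yᶜ + x) = 1 := by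
  have h := mv_minus_inf_minus x y
  have h2 := congrArg (fun z : A => zᶜ) h
  simpa only [mv_inf_def, mv_compl_compl, odot, mv_compl_zero] using h2

theorem mv_le_compl_of_square {a b : A} (ha : a ≤ aᶜ) (hb : b ≤ bᶜ) : a ≤ bᶜ := by
  have h1 : aᶜ + b ≤ (odot a b)ᶜ := by
    apply mv_le_compl_comm
    rw [← mv_odot_eq_zero_iff, mv_odot_comm a b, mv_odot_assoc, mv_odot_compl_add,
      ← mv_le_zero_iff]
    refine (mv_odot_mono le_rfl inf_le_right).trans ?_
    rw [mv_le_zero_iff, mv_odot_eq_zero_iff]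
    exact hb
  have h2 : bᶜ + a ≤ (odot a b)ᶜ := by
    apply mv_le_compl_comm
    rw [← mv_odot_eq_zero_iff, mv_odot_assoc, mv_odot_compl_add, ← mv_le_zero_iff]
    refine (mv_odot_mono le_rfl inf_le_right).trans ?_
    rw [mv_le_zero_iff, mv_odot_eq_zero_iff]
    exact ha
  have h3 := sup_le h1 h2
  rw [mv_prelinear] at h3
  have h4 := mv_le_compl_comm h3
  rw [mv_compl_one, mv_le_zero_iff, mv_odot_eq_zero_iff] at h4
  exact h4

theorem mv_partial_assoc {a b c : A} (h1 : a ≤ bᶜ) (h2 : a + b ≤ cᶜ) : a ≤ (b + c)ᶜ := by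
  have h3 : a = odot bᶜ (b + a) := by
    have := mv_odot_compl_add bᶜ a
    rw [mv_compl_compl, inf_eq_right.2 h1] at this
    exact this.symm
  have h4 : odot bᶜ (b + a) ≤ odot bᶜ cᶜ := mv_odot_mono le_rfl (by rwa [add_comm])
  rw [← h3, odot, mv_compl_compl, mv_compl_compl] at h4
  exact h4

theorem mv_partial_assoc_rev {a b c : A} (h1 : b ≤ cᶜ) (h2 : a ≤ (b + c)ᶜ) : a + b ≤ cᶜ := by
  have h3 := mv_add_le_add h2 (le_refl b)
  have h4 := mv_join_eq h1
  rw [mv_compl_compl, add_comm c b] at h4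
  rwa [h4] at h3

end Basic

/-! ### The radical, perfect MV-algebras, and `θ` -/

/-- `x` is infinitesimal if `n x ≤ ¬ x` for every positive integer `n`; the radical is the set of
all infinitesimals. -/
def rad (A : Type u) [MVAlgebra A] : Set A := {x | ∀ n : ℕ, 0 < n → n • x ≤ xᶜ}

/-- Subalgebras of an MV-algebra. -/
structure IsSubalgebra {A : Type u} [MVAlgebra A] (S : Set A) : Prop where
  zero_mem : 0 ∈ S
  add_mem : ∀ x ∈ S, ∀ y ∈ S, x + y ∈ S
  compl_mem : ∀ x ∈ S, xᶜ ∈ S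

/-- The subalgebra generated by a set. -/
def generatedBy {A : Type u} [MVAlgebra A] (X : Set A) : Set A :=
  ⋂₀ {S : Set A | IsSubalgebra S ∧ X ⊆ S}

/-- A perfect MV-algebra is a nontrivial MV-algebra generated by its radical. -/
structure IsPerfect (A : Type u) [MVAlgebra A] : Prop where
  zero_ne_one : (0 : A) ≠ 1
  generated : generatedBy (rad A) = Set.univ

/-- `θ(A) = {x | x ≥ 2 x²}`, where `x² = x ⊙ x` and `2 x = x ⊕ x`. -/
def theta (A : Type u) [MVAlgebra A] : Set A := {x | x ≥ 2 • odot x x}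

section Radical

variable {A : Type u} [MVAlgebra A]

theorem zero_mem_rad : (0 : A) ∈ rad A := fun n _ => by
  rw [smul_zero]
  exact mv_zero_le _

theorem nsmul_mono {x y : A} (h : x ≤ y) (n : ℕ) : n • x ≤ n • y := by
  induction n with
  | zero => rw [zero_smul, zero_smul]
  | succ n ih =>
    rw [succ_nsmul, succ_nsmul]
    exact mv_add_le_add ih h

theorem rad_of_le {x y : A} (hx : x ∈ rad A) (h : y ≤ x) : y ∈ rad A := fun n hn =>
  ((nsmul_mono h n).trans (hx n hn)).trans (mv_compl_le_compl h)

theorem nsmul_le_compl_nsmul {x : A} (hx : x ∈ rad A) (m n : ℕ) : m • x ≤ (n • x)ᶜ := by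
  induction n generalizing m with
  | zero =>
    rw [zero_smul, mv_compl_zero]
    exact mv_le_one _
  | succ n ih =>
    have h1 : m • x ≤ xᶜ := by
      rcases Nat.eq_zero_or_pos m with rfl | hm
      · rw [zero_smul]
        exact mv_zero_le _
      · exact hx m hm
    have h2 := ih (m + 1)
    rw [succ_nsmul] at h2
    have h3 := mv_partial_assoc h1 h2
    rwa [succ_nsmul']

theorem add_mem_rad {x y : A} (hx : x ∈ rad A) (hy : y ∈ rad A) : x + y ∈ rad A := by
  have key : ∀ n : ℕ, n • (x + y) ≤ (n • (x + y))ᶜ := by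
    intro n
    rw [smul_add]
    have hp := nsmul_le_compl_nsmul hx n n
    have hq := nsmul_le_compl_nsmul hy n n
    have hu := nsmul_le_compl_nsmul hx (n + n) (n + n)
    have hv := nsmul_le_compl_nsmul hy (n + n) (n + n)
    have huv := mv_le_compl_of_square hu hv
    rw [add_smul, add_smul] at huv
    have h1 := mv_partial_assoc hp huv
    have h2 := mv_partial_assoc hq (mv_le_compl_comm huv)
    refine mv_partial_assoc_rev ?_ ?_
    · refine h2.trans (mv_compl_le_compl ?_)
      exact ⟨n • x, by abel⟩
    · refine h1.trans (le_of_eq ?_)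
      congr 1
      abel
  intro n _
  have h1 := key 1
  rw [one_smul] at h1
  exact mv_le_compl_of_square (key n) h1

theorem mv_square_eq_zero {x : A} (hx : x ∈ rad A) : odot x x = 0 := by
  rw [mv_odot_eq_zero_iff]
  simpa using nsmul_le_compl_nsmul hx 1 1

theorem rad_subset_theta {x : A} (hx : x ∈ rad A) : x ∈ theta A := by
  change 2 • odot x x ≤ x
  rw [mv_square_eq_zero hx, smul_zero]
  exact mv_zero_le x

theorem one_mem_theta : (1 : A) ∈ theta A := mv_le_one _

theorem IsPerfect.mem_or (h : IsPerfect A) (x : A) : x ∈ rad A ∨ xᶜ ∈ rad A := by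
  have hx : x ∈ generatedBy (rad A) := by
    rw [h.generated]
    trivial
  refine hx {x | x ∈ rad A ∨ xᶜ ∈ rad A} ⟨⟨Or.inl zero_mem_rad, ?_, ?_⟩, fun y hy => Or.inl hy⟩
  · rintro y (hy | hy) z (hz | hz)
    · exact Or.inl (add_mem_rad hy hz)
    · exact Or.inr (rad_of_le hz (mv_compl_le_compl (mv_le_add_left _ _)))
    · exact Or.inr (rad_of_le hy (mv_compl_le_compl (mv_le_add_right _ _)))
    · exact Or.inr (rad_of_le hy (mv_compl_le_compl (mv_le_add_right _ _)))
  · rintro y (hy | hy)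
    · exact Or.inr (by rwa [mv_compl_compl])
    · exact Or.inl hy

theorem IsPerfect.mem_theta_iff (h : IsPerfect A) (x : A) : x ∈ theta A ↔ x ∈ rad A ∨ x = 1 := by
  constructor
  · intro hx
    rcases h.mem_or x with hr | hr
    · exact Or.inl hr
    · right
      have h1 : (2 • xᶜ) ≤ (2 • xᶜ)ᶜ := nsmul_le_compl_nsmul hr 2 2
      have h2 : (2 • xᶜ)ᶜ + (2 • xᶜ)ᶜ = 1 := mv_le_iff.1 h1
      have h3 : odot x x = (2 • xᶜ)ᶜ := by rw [odot, two_nsmul]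
      have h4 : 2 • odot x x ≤ x := hx
      rw [h3, two_nsmul, h2] at h4
      exact le_antisymm (mv_le_one x) h4
  · rintro (hx | rfl)
    · exact rad_subset_theta hx
    · exact one_mem_theta

theorem IsPerfect.one_notMem_rad (h : IsPerfect A) : (1 : A) ∉ rad A := fun h1 => by
  have h2 := h1 1 one_pos
  rw [one_smul, mv_compl_one, mv_le_zero_iff] at h2
  exact h.zero_ne_one h2.symm

theorem IsPerfect.add_mem_theta (h : IsPerfect A) {x y : A} (hx : x ∈ theta A)
    (hy : y ∈ theta A) : x + y ∈ theta A := by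
  rw [h.mem_theta_iff] at *
  rcases hx with hx | rfl
  · rcases hy with hy | rfl
    · exact Or.inl (add_mem_rad hx hy)
    · exact Or.inr (mv_add_one x)
  · exact Or.inr (by rw [add_comm, mv_add_one])

theorem IsPerfect.inf_mem_theta (h : IsPerfect A) {x y : A} (hx : x ∈ theta A)
    (hy : y ∈ theta A) : x ⊓ y ∈ theta A := by
  rw [h.mem_theta_iff] at *
  rcases hx with hx | rfl
  · exact Or.inl (rad_of_le hx inf_le_left)
  · rwa [inf_eq_right.2 (mv_le_one y)]

theorem IsPerfect.sup_mem_theta (h : IsPerfect A) {x y : A} (hx : x ∈ theta A)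
    (hy : y ∈ theta A) : x ⊔ y ∈ theta A := by
  rw [h.mem_theta_iff] at *
  rcases hx with hx | rfl
  · rcases hy with hy | rfl
    · exact Or.inl (rad_of_le (add_mem_rad hx hy) (mv_sup_le_add x y))
    · exact Or.inr (sup_eq_right.2 (mv_le_one x))
  · exact Or.inr (sup_eq_left.2 (mv_le_one y))

end Radical

end MVAlgebra

open MVAlgebra

/-! ### The category of MV-algebras and the category `PERF` of perfect MV-algebras -/

/-- Homomorphisms of MV-algebras. -/
@[ext]
structure MVHom (A B : Type u) [MVAlgebra A] [MVAlgebra B] where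
  toFun : A → B
  map_zero : toFun 0 = 0
  map_one : toFun 1 = 1
  map_add : ∀ x y, toFun (x + y) = toFun x + toFun y
  map_compl : ∀ x, toFun xᶜ = (toFun x)ᶜ

namespace MVHom

variable {A B : Type u} [MVAlgebra A] [MVAlgebra B] (f : MVHom A B)

theorem map_le {x y : A} (h : x ≤ y) : f.toFun x ≤ f.toFun y := by
  obtain ⟨z, rfl⟩ := h
  exact ⟨f.toFun z, f.map_add x z⟩

theorem map_nsmul (n : ℕ) (x : A) : f.toFun (n • x) = n • f.toFun x := by
  induction n with
  | zero => rw [zero_smul, zero_smul, f.map_zero]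
  | succ n ih => rw [succ_nsmul, succ_nsmul, f.map_add, ih]

theorem map_sup (x y : A) : f.toFun (x ⊔ y) = f.toFun x ⊔ f.toFun y := by
  simp only [mv_sup_def, f.map_add, f.map_compl]

theorem map_inf (x y : A) : f.toFun (x ⊓ y) = f.toFun x ⊓ f.toFun y := by
  simp only [mv_inf_def, f.map_sup, f.map_compl]

theorem map_odot (x y : A) : f.toFun (odot x y) = odot (f.toFun x) (f.toFun y) := by
  simp only [odot, f.map_add, f.map_compl]

theorem map_rad {x : A} (hx : x ∈ rad A) : f.toFun x ∈ rad B := fun n hn => by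
  have := f.map_le (hx n hn)
  rwa [map_nsmul, map_compl] at this

theorem map_theta {x : A} (hx : x ∈ theta A) : f.toFun x ∈ theta B := by
  have := f.map_le hx
  rwa [map_nsmul, map_odot] at this

end MVHom

/-- MV-algebras, as objects of a category. -/
structure MVAlg where
  carrier : Type u
  [str : MVAlgebra carrier]

attribute [instance] MVAlg.str

instance : Category MVAlg.{u} where
  Hom A B := MVHom A.carrier B.carrier
  id _ := ⟨fun x => x, rfl, rfl, fun _ _ => rfl, fun _ => rfl⟩
  comp f g :=
    { toFun := fun x => g.toFun (f.toFun x)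
      map_zero := by rw [f.map_zero, g.map_zero]
      map_one := by rw [f.map_one, g.map_one]
      map_add := fun x y => by rw [f.map_add, g.map_add]
      map_compl := fun x => by rw [f.map_compl, g.map_compl] }

/-- The category of perfect MV-algebras, a full subcategory of the category of MV-algebras. -/
abbrev PERF : Type (u + 1) :=
  ObjectProperty.FullSubcategory (C := MVAlg.{u}) fun A => IsPerfect A.carrier

/-! ### The category of abelian `ℓ`-groups -/

/-- Abelian lattice-ordered groups, as objects of a category. -/
structure LGrp where
  carrier : Type u
  [addCommGroup : AddCommGroup carrier]
  [lattice : Lattice carrier]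
  [isOrdered : IsOrderedAddMonoid carrier]

attribute [instance] LGrp.addCommGroup LGrp.lattice LGrp.isOrdered

/-- Homomorphisms of `ℓ`-groups: group homomorphisms that are lattice homomorphisms. -/
@[ext]
structure LGrpHom (G H : Type u) [AddCommGroup G] [Lattice G] [AddCommGroup H] [Lattice H] where
  toFun : G → H
  map_add : ∀ x y, toFun (x + y) = toFun x + toFun y
  map_inf : ∀ x y, toFun (x ⊓ y) = toFun x ⊓ toFun y
  map_sup : ∀ x y, toFun (x ⊔ y) = toFun x ⊔ toFun y

instance : Category LGrp.{u} where
  Hom G H := LGrpHom G.carrier H.carrier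
  id _ := ⟨fun x => x, fun _ _ => rfl, fun _ _ => rfl, fun _ _ => rfl⟩
  comp f g :=
    { toFun := fun x => g.toFun (f.toFun x)
      map_add := fun x y => by rw [f.map_add, g.map_add]
      map_inf := fun x y => by rw [f.map_inf, g.map_inf]
      map_sup := fun x y => by rw [f.map_sup, g.map_sup] }

namespace LGrpHom

variable {G H : Type u} [AddCommGroup G] [Lattice G] [AddCommGroup H] [Lattice H]
  (f : LGrpHom G H)

theorem map_zero : f.toFun 0 = 0 := by
  have h := f.map_add 0 0
  rw [add_zero] at h
  exact left_eq_add.1 h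

theorem map_sub (x y : G) : f.toFun (x - y) = f.toFun x - f.toFun y := by
  rw [eq_sub_iff_add_eq, ← f.map_add, sub_add_cancel]

theorem map_le {x y : G} (h : x ≤ y) : f.toFun x ≤ f.toFun y := by
  rw [← sup_eq_right, ← f.map_sup, sup_eq_right.2 h]

end LGrpHom

/-! ### The functor `Δ` -/

section Gamma

/-- The interval `[0, e]` of an abelian `ℓ`-group. -/
@[ext]
structure Gamma (G : Type u) [AddCommGroup G] [Lattice G] (e : G) : Type u where
  val : G
  mem_interval : 0 ≤ val ∧ val ≤ e

variable {G : Type u} [AddCommGroup G] [Lattice G] [IsOrderedAddMonoid G]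

theorem gamma_trunc (e a b c : G) (hc : 0 ≤ c) : ((a + b) ⊓ e + c) ⊓ e = (a + b + c) ⊓ e := by
  rw [inf_add, inf_assoc, inf_eq_right.2 (le_add_of_nonneg_right hc)]

theorem gamma_join (e x y : G) (hx : x ≤ e) (hy : y ≤ e) :
    (e - (e - x + y) ⊓ e + y) ⊓ e = x ⊔ y := by
  have h : e - (e - x + y) ⊓ e + y = x ⊔ y := by
    rw [sub_inf, sup_add]
    congr 1 <;> abel
  rw [h]
  exact inf_eq_left.2 (sup_le hx hy)

/-- The MV-algebra `Γ(G, e)`: the interval `[0, e]` with `x ⊕ y = (x + y) ∧ e` and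
`¬ x = e - x`. -/
@[reducible]
def gammaMV (e : G) (he : 0 ≤ e) : MVAlgebra (Gamma G e) where
  add x y := ⟨(x.1 + y.1) ⊓ e, le_inf (add_nonneg x.2.1 y.2.1) he, inf_le_right⟩
  zero := ⟨0, le_rfl, he⟩
  one := ⟨e, he, le_rfl⟩
  compl x := ⟨e - x.1, sub_nonneg.2 x.2.2, sub_le_self _ x.2.1⟩
  add_assoc x y z := Gamma.ext <| by
    change ((x.1 + y.1) ⊓ e + z.1) ⊓ e = (x.1 + (y.1 + z.1) ⊓ e) ⊓ e
    rw [gamma_trunc e _ _ _ z.2.1, add_comm x.1 ((y.1 + z.1) ⊓ e), gamma_trunc e _ _ _ x.2.1]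
    congr 1
    abel
  zero_add x := Gamma.ext <| by
    change (0 + x.1) ⊓ e = x.1
    rw [zero_add, inf_eq_left.2 x.2.2]
  add_zero x := Gamma.ext <| by
    change (x.1 + 0) ⊓ e = x.1
    rw [add_zero, inf_eq_left.2 x.2.2]
  add_comm x y := Gamma.ext <| by
    change (x.1 + y.1) ⊓ e = (y.1 + x.1) ⊓ e
    rw [add_comm]
  nsmul := @nsmulRec _ ⟨⟨0, le_rfl, he⟩⟩
    ⟨fun x y => ⟨(x.1 + y.1) ⊓ e, le_inf (add_nonneg x.2.1 y.2.1) he, inf_le_right⟩⟩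
  mv_compl_zero := Gamma.ext (sub_zero e)
  mv_add_one x := Gamma.ext <| by
    change (x.1 + e) ⊓ e = e
    exact inf_eq_right.2 (le_add_of_nonneg_left x.2.1)
  mv_compl_compl x := Gamma.ext (sub_sub_cancel e x.1)
  mv_lukasiewicz x y := Gamma.ext <| by
    change (e - (e - x.1 + y.1) ⊓ e + y.1) ⊓ e = (e - (e - y.1 + x.1) ⊓ e + x.1) ⊓ e
    rw [gamma_join e _ _ x.2.2 y.2.2, gamma_join e _ _ y.2.2 x.2.2, sup_comm]

end Gamma

section LexLattice

variable {G : Type u} [Lattice G]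

/-- The lattice structure of the lexicographic product of `ℤ` with a lattice; the order is
Mathlib's lexicographic order. -/
noncomputable instance lexIntLattice : Lattice (ℤ ×ₗ G) where
  toPartialOrder := Prod.Lex.instPartialOrder ℤ G
  sup x y := if (ofLex x).1 < (ofLex y).1 then y else if (ofLex y).1 < (ofLex x).1 then x
    else toLex ((ofLex x).1, (ofLex x).2 ⊔ (ofLex y).2)
  inf x y := if (ofLex x).1 < (ofLex y).1 then x else if (ofLex y).1 < (ofLex x).1 then y
    else toLex ((ofLex x).1, (ofLex x).2 ⊓ (ofLex y).2)
  le_sup_left x y := by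
    split_ifs with h1 h2
    · exact Prod.Lex.le_iff.2 (Or.inl h1)
    · exact le_rfl
    · exact Prod.Lex.le_iff.2 (Or.inr ⟨rfl, le_sup_left⟩)
  le_sup_right x y := by
    split_ifs with h1 h2
    · exact le_rfl
    · exact Prod.Lex.le_iff.2 (Or.inl h2)
    · exact Prod.Lex.le_iff.2 (Or.inr ⟨le_antisymm (not_lt.1 h1) (not_lt.1 h2), le_sup_right⟩)
  sup_le x y z hx hy := by
    split_ifs with h1 h2
    · exact hy
    · exact hx
    · rw [Prod.Lex.le_iff] at hx hy ⊢
      rcases hx with hx | hx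
      · exact Or.inl hx
      · rcases hy with hy | hy
        · exact Or.inl ((not_lt.1 h1).antisymm (not_lt.1 h2) ▸ hy)
        · exact Or.inr ⟨hx.1, sup_le hx.2 hy.2⟩
  inf_le_left x y := by
    split_ifs with h1 h2
    · exact le_rfl
    · exact Prod.Lex.le_iff.2 (Or.inl h2)
    · exact Prod.Lex.le_iff.2 (Or.inr ⟨rfl, inf_le_left⟩)
  inf_le_right x y := by
    split_ifs with h1 h2
    · exact Prod.Lex.le_iff.2 (Or.inl h1)
    · exact le_rfl
    · exact Prod.Lex.le_iff.2 (Or.inr ⟨le_antisymm (not_lt.1 h2) (not_lt.1 h1), inf_le_right⟩)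
  le_inf x y z hx hy := by
    split_ifs with h1 h2
    · exact hx
    · exact hy
    · rw [Prod.Lex.le_iff] at hx hy ⊢
      rcases hx with hx | hx
      · exact Or.inl hx
      · rcases hy with hy | hy
        · exact Or.inl (lt_of_lt_of_le hy (not_lt.1 h1))
        · exact Or.inr ⟨hx.1, le_inf hx.2 hy.2⟩

theorem lex_inf_def (x y : ℤ ×ₗ G) : x ⊓ y =
    if (ofLex x).1 < (ofLex y).1 then x else if (ofLex y).1 < (ofLex x).1 then y
    else toLex ((ofLex x).1, (ofLex x).2 ⊓ (ofLex y).2) := rfl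

theorem lex_sup_def (x y : ℤ ×ₗ G) : x ⊔ y =
    if (ofLex x).1 < (ofLex y).1 then y else if (ofLex y).1 < (ofLex x).1 then x
    else toLex ((ofLex x).1, (ofLex x).2 ⊔ (ofLex y).2) := rfl

end LexLattice

section Delta

/-- The unit `(1, 0)` of the lexicographic product of `ℤ` with `G`. -/
def lexUnit (G : Type u) [AddCommGroup G] : ℤ ×ₗ G := toLex (1, 0)

theorem lexUnit_nonneg (G : Type u) [AddCommGroup G] [Lattice G] : 0 ≤ lexUnit G :=
  Prod.Lex.le_iff.2 (Or.inl zero_lt_one)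

variable (G : Type u) [AddCommGroup G] [Lattice G] [IsOrderedAddMonoid G]

/-- The underlying set of `Δ(G) = Γ(ℤ ×ₗ G, (1, 0))`. -/
abbrev DeltaCarrier : Type u := Gamma (ℤ ×ₗ G) (lexUnit G)

noncomputable instance deltaMV : MVAlgebra (DeltaCarrier G) := gammaMV (lexUnit G) (lexUnit_nonneg G)


variable {G}

theorem delta_add_val (x y : DeltaCarrier G) : (x + y).1 = (x.1 + y.1) ⊓ lexUnit G := rfl

theorem delta_zero_val : (0 : DeltaCarrier G).1 = 0 := rfl

theorem delta_one_val : (1 : DeltaCarrier G).1 = lexUnit G := rfl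

theorem delta_compl_val (x : DeltaCarrier G) : xᶜ.1 = lexUnit G - x.1 := rfl

theorem delta_add_fst {x y : DeltaCarrier G} (hx : (ofLex x.1).1 = 0) (hy : (ofLex y.1).1 = 0) :
    (ofLex (x + y).1).1 = 0 := by
  have h : (ofLex (x.1 + y.1)).1 = 0 := by
    change (ofLex x.1).1 + (ofLex y.1).1 = 0
    rw [hx, hy, add_zero]
  have h2 : (ofLex (x.1 + y.1)).1 < (ofLex (lexUnit G)).1 := by
    rw [h]
    exact zero_lt_one
  rw [delta_add_val, lex_inf_def, if_pos h2, h]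

theorem delta_mem_rad {x : DeltaCarrier G} (hx : (ofLex x.1).1 = 0) :
    x ∈ rad (DeltaCarrier G) := by
  intro n _
  have hn : (ofLex (n • x).1).1 = 0 := by
    induction n with
    | zero =>
      rw [zero_smul]
      rfl
    | succ n ih =>
      rw [succ_nsmul]
      rcases Nat.eq_zero_or_pos n with rfl | h
      · rw [zero_smul, zero_add, hx]
      · exact delta_add_fst (ih h) hx
  rw [mv_le_iff]
  apply Gamma.ext
  rw [delta_add_val, delta_one_val, delta_compl_val, delta_compl_val]
  refine inf_eq_right.2 (Prod.Lex.le_iff.2 (Or.inl ?_))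
  change (1 : ℤ) < (1 - (ofLex (n • x).1).1) + (1 - (ofLex x.1).1)
  rw [hn, hx]
  norm_num

variable (G) in
theorem delta_isPerfect : IsPerfect (DeltaCarrier G) where
  zero_ne_one h := by
    have h2 : (0 : ℤ) = 1 := congrArg (fun x : DeltaCarrier G => (ofLex x.1).1) h
    exact zero_ne_one h2
  generated := by
    refine Set.eq_univ_of_forall fun x S hS => ?_
    have hx1 : 0 ≤ (ofLex x.1).1 := by
      rcases Prod.Lex.le_iff.1 x.2.1 with h | h
      · exact h.le
      · exact h.1.le
    have hx2 : (ofLex x.1).1 ≤ 1 := by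
      rcases Prod.Lex.le_iff.1 x.2.2 with h | h
      · exact h.le
      · exact h.1.le
    rcases hx1.eq_or_lt with h | h
    · exact hS.2 (delta_mem_rad h.symm)
    · have h1 : (ofLex x.1).1 = 1 := by omega
      have h2 : (ofLex xᶜ.1).1 = 0 := by
        change (1 : ℤ) - (ofLex x.1).1 = 0
        rw [h1, sub_self]
      have h3 := hS.1.compl_mem _ (hS.2 (delta_mem_rad h2))
      rwa [mv_compl_compl] at h3

variable {H : Type u} [AddCommGroup H] [Lattice H] [IsOrderedAddMonoid H]

/-- The homomorphism `(n, g) ↦ (n, f g)` of lexicographic products induced by `f`. -/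
def lexMap (f : LGrpHom G H) : LGrpHom (ℤ ×ₗ G) (ℤ ×ₗ H) where
  toFun x := toLex ((ofLex x).1, f.toFun (ofLex x).2)
  map_add x y := congrArg toLex (Prod.ext rfl (f.map_add _ _))
  map_inf x y := by
    rw [lex_inf_def]
    split_ifs with h1 h2
    · exact (if_pos h1).symm
    · exact ((if_neg h1).trans (if_pos h2)).symm
    · refine Eq.trans ?_ ((if_neg h1).trans (if_neg h2)).symm
      exact congrArg toLex (Prod.ext rfl (f.map_inf _ _))
  map_sup x y := by
    rw [lex_sup_def]
    split_ifs with h1 h2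
    · exact (if_pos h1).symm
    · exact ((if_neg h1).trans (if_pos h2)).symm
    · refine Eq.trans ?_ ((if_neg h1).trans (if_neg h2)).symm
      exact congrArg toLex (Prod.ext rfl (f.map_sup _ _))

theorem lexMap_unit {G H : Type u} [AddCommGroup G] [Lattice G] [AddCommGroup H] [Lattice H]
    (f : LGrpHom G H) : (lexMap f).toFun (lexUnit G) = lexUnit H :=
  congrArg toLex (Prod.ext rfl f.map_zero)

/-- The homomorphism `Δ(f) : Δ(G) → Δ(H)`, `(n, g) ↦ (n, f g)`. -/
def deltaMap (f : LGrpHom G H) : MVHom (DeltaCarrier G) (DeltaCarrier H) where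
  toFun x := ⟨(lexMap f).toFun x.1,
    by
      have h := (lexMap f).map_le x.2.1
      rwa [(lexMap f).map_zero] at h,
    by
      have h := (lexMap f).map_le x.2.2
      rwa [lexMap_unit] at h⟩
  map_zero := Gamma.ext (lexMap f).map_zero
  map_one := Gamma.ext (lexMap_unit f)
  map_add x y := Gamma.ext <| by
    change (lexMap f).toFun ((x.1 + y.1) ⊓ lexUnit G) =
      ((lexMap f).toFun x.1 + (lexMap f).toFun y.1) ⊓ lexUnit H
    rw [(lexMap f).map_inf, (lexMap f).map_add, lexMap_unit]
  map_compl x := Gamma.ext <| by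
    change (lexMap f).toFun (lexUnit G - x.1) = lexUnit H - (lexMap f).toFun x.1
    rw [(lexMap f).map_sub, lexMap_unit]

end Delta

/-- The functor `Δ` from abelian `ℓ`-groups to perfect MV-algebras,
`Δ(G) = Γ(ℤ ×ₗ G, (1, 0))`. -/
noncomputable def Delta : LGrp.{u} ⥤ PERF.{u} where
  obj G := ⟨⟨DeltaCarrier G.carrier⟩, delta_isPerfect G.carrier⟩
  map f := ObjectProperty.homMk (deltaMap f)

/-! ### The category `TOP` of positive cones of `ℓ`-groups with a top -/

/-- Lattices with a top element and with a commutative monoid structure, as objects of a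
category. -/
structure LatMonTop where
  carrier : Type u
  [addCommMonoid : AddCommMonoid carrier]
  [lattice : Lattice carrier]
  [orderTop : OrderTop carrier]

attribute [instance] LatMonTop.addCommMonoid LatMonTop.lattice LatMonTop.orderTop

/-- Homomorphisms for `+`, `0`, `∧`, `∨` that preserve the top and also preserve the part below
the top (in the case of positive cones with a top added: the positive cone). -/
@[ext]
structure LatMonTopHom (S T : Type u) [AddCommMonoid S] [Lattice S] [OrderTop S]
    [AddCommMonoid T] [Lattice T] [OrderTop T] where
  toFun : S → T
  map_zero : toFun 0 = 0
  map_add : ∀ x y, toFun (x + y) = toFun x + toFun y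
  map_inf : ∀ x y, toFun (x ⊓ y) = toFun x ⊓ toFun y
  map_sup : ∀ x y, toFun (x ⊔ y) = toFun x ⊔ toFun y
  map_top : toFun ⊤ = ⊤
  map_cone : ∀ x, x ≠ ⊤ → toFun x ≠ ⊤

instance : Category LatMonTop.{u} where
  Hom S T := LatMonTopHom S.carrier T.carrier
  id _ := ⟨fun x => x, rfl, fun _ _ => rfl, fun _ _ => rfl, fun _ _ => rfl, rfl, fun _ h => h⟩
  comp f g :=
    { toFun := fun x => g.toFun (f.toFun x)
      map_zero := by rw [f.map_zero, g.map_zero]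
      map_add := fun x y => by rw [f.map_add, g.map_add]
      map_inf := fun x y => by rw [f.map_inf, g.map_inf]
      map_sup := fun x y => by rw [f.map_sup, g.map_sup]
      map_top := by rw [f.map_top, g.map_top]
      map_cone := fun x hx => g.map_cone _ (f.map_cone x hx) }

/-- The positive cone of an `ℓ`-group is a sublattice. -/
@[reducible]
def coneLattice (G : LGrp.{u}) : Lattice {g : G.carrier // 0 ≤ g} :=
  Subtype.lattice (fun _ _ hx _ => le_sup_of_le_left hx) (fun _ _ hx hy => le_inf hx hy)

/-- The positive cone `{g | 0 ≤ g}` of an abelian `ℓ`-group with a new top element `⊤` added, where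
`x + ⊤ = ⊤`. -/
noncomputable def coneWithTop (G : LGrp.{u}) : LatMonTop.{u} where
  carrier := WithTop {g : G.carrier // 0 ≤ g}
  lattice := @WithTop.lattice _ (coneLattice G)
  orderTop := inferInstanceAs (OrderTop (WithTop {g : G.carrier // 0 ≤ g}))

/-- `S` is, up to isomorphism, the positive cone of an abelian `ℓ`-group with a top added. -/
def IsConeWithTop : ObjectProperty LatMonTop.{u} := fun S =>
  ∃ G : LGrp.{u}, Nonempty (S ≅ coneWithTop G)

/-- The category of positive cones of abelian `ℓ`-groups with a top. -/
abbrev TOP : Type (u + 1) := IsConeWithTop.{u}.FullSubcategory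

/-! ### The functor `θ` on perfect MV-algebras -/

/-- `θ(P)` for a perfect MV-algebra `P`, with the operations `⊕`, `∧`, `∨`, `0`, `1` of `P`. -/
def thetaObj (P : PERF.{u}) : LatMonTop.{u} where
  carrier := {x : P.obj.carrier // x ∈ theta P.obj.carrier}
  addCommMonoid :=
    { add := fun x y => ⟨x.1 + y.1, P.property.add_mem_theta x.2 y.2⟩
      zero := ⟨0, rad_subset_theta zero_mem_rad⟩
      add_assoc := fun _ _ _ => Subtype.ext (add_assoc _ _ _)
      zero_add := fun _ => Subtype.ext (zero_add _)
      add_zero := fun _ => Subtype.ext (add_zero _)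
      add_comm := fun _ _ => Subtype.ext (add_comm _ _)
      nsmul := @nsmulRec _ ⟨⟨0, rad_subset_theta zero_mem_rad⟩⟩
        ⟨fun x y => ⟨x.1 + y.1, P.property.add_mem_theta x.2 y.2⟩⟩ }
  lattice := Subtype.lattice (fun _ _ hx hy => P.property.sup_mem_theta hx hy)
    (fun _ _ hx hy => P.property.inf_mem_theta hx hy)
  orderTop :=
    { top := ⟨1, one_mem_theta⟩
      le_top := fun x => mv_le_one x.1 }

/-- `θ`, sending a perfect MV-algebra `P` to `θ(P)` and a homomorphism to its restriction. -/
def thetaFunctor : PERF.{u} ⥤ LatMonTop.{u} where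
  obj P := thetaObj P
  map {P Q} f :=
    { toFun := fun x => ⟨f.hom.toFun x.1, f.hom.map_theta x.2⟩
      map_zero := Subtype.ext f.hom.map_zero
      map_add := fun x y => Subtype.ext (f.hom.map_add x.1 y.1)
      map_inf := fun x y => Subtype.ext (f.hom.map_inf x.1 y.1)
      map_sup := fun x y => Subtype.ext (f.hom.map_sup x.1 y.1)
      map_top := Subtype.ext f.hom.map_one
      map_cone := fun x hx h => by
        rcases (P.property.mem_theta_iff x.1).1 x.2 with hr | h1
        · have h2 : f.hom.toFun x.1 = 1 := congrArg Subtype.val h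
          have h3 := f.hom.map_rad hr
          rw [h2] at h3
          exact Q.property.one_notMem_rad h3
        · exact hx (Subtype.ext h1) }

/-! ### The Grothendieck group of a cancellative lattice monoid -/

section Grothendieck

open Algebra

variable {M : Type u} [AddCommMonoid M] [Lattice M] [IsOrderedCancelAddMonoid M]

/-! A perfect MV-algebra is the disjoint union of its radical and the complements of the radical, so
everything is decided on the radical. There sums are never truncated: `odot xᶜ (x + y) = y` for
infinitesimal `x` and `y`. Hence the radical is a cancellative lattice monoid whose order is the
divisibility order of its addition, and such a monoid is the positive cone of its Grothendieck
group. Adding 1 as top gives `isConeWithTop_theta`.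

`θ` is faithful because a homomorphism is determined on the radical (`MVHom.ext_of_rad`). It is full
because a map of radicals extends by `f xᶜ = (f x)ᶜ` (`MVHom.ofRad`); the decisive point is that
truncated differences are preserved, which follows from `odot x yᶜ + y = x ⊔ y` and cancellation.

The radical of `Δ(G)` consists of the pairs `(0, g)` with `g ≥ 0`, so `θ(Δ(G))` is the cone of `G`
with a top. This makes `Δ ⋙ θ`, and therefore `θ`, essentially surjective. Finally `Δ` is fully
faithful: a homomorphism `Δ(G) → Δ(H)` restricts to the cones and extends to the groups by
differences. -/

theorem grothendieck_of_le_of {a b : M} :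
    GrothendieckAddGroup.of a ≤ GrothendieckAddGroup.of b ↔ a ≤ b :=
  (AddLocalization.mkOrderEmbedding (0 : (⊤ : AddSubmonoid M))).le_iff_le

theorem grothendieck_exists_sub (x : GrothendieckAddGroup M) :
    ∃ a c : M, x = GrothendieckAddGroup.of a - GrothendieckAddGroup.of c := by
  induction x using AddLocalization.ind with
  | _ y =>
    refine ⟨y.1, y.2, ?_⟩
    rw [eq_sub_iff_add_eq]
    change AddLocalization.mk y.1 y.2 + AddLocalization.mk (y.2 : M) 0 = AddLocalization.mk y.1 0
    rw [AddLocalization.mk_add, AddLocalization.mk_eq_mk_iff']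
    simp [add_comm]

theorem grothendieck_exists_sub_sub (x y : GrothendieckAddGroup M) :
    ∃ a b c : M, x = GrothendieckAddGroup.of a - GrothendieckAddGroup.of c ∧
      y = GrothendieckAddGroup.of b - GrothendieckAddGroup.of c := by
  obtain ⟨a, c, rfl⟩ := grothendieck_exists_sub x
  obtain ⟨b, d, rfl⟩ := grothendieck_exists_sub y
  refine ⟨a + d, b + c, c + d, ?_, ?_⟩ <;> simp only [map_add] <;> abel

theorem grothendieck_sub_le_sub {a b c d : M} :
    GrothendieckAddGroup.of a - GrothendieckAddGroup.of c ≤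
      GrothendieckAddGroup.of b - GrothendieckAddGroup.of d ↔ a + d ≤ b + c := by
  rw [sub_le_sub_iff, ← map_add, ← map_add, grothendieck_of_le_of]

/-- In a group one would translate back by `-c`. Here the join on the right lies above `c`, so the
divisibility order writes it as `d + c`; cancelling `c` shows that `d` bounds `a` and `b`. -/
theorem sup_add_eq_of_exists_add (hM : ∀ a b : M, a ≤ b ↔ ∃ c, b = a + c) (a b c : M) :
    (a ⊔ b) + c = (a + c) ⊔ (b + c) := by
  refine le_antisymm ?_ (sup_le (add_le_add_left le_sup_left c) (add_le_add_left le_sup_right c))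
  have hc : c ≤ (a + c) ⊔ (b + c) := ((hM _ _).2 ⟨a, add_comm _ _⟩).trans le_sup_left
  obtain ⟨d, hd⟩ := (hM _ _).1 hc
  rw [add_comm c d] at hd
  rw [hd, add_le_add_iff_right]
  refine sup_le ?_ ?_ <;> rw [← add_le_add_iff_right c, ← hd]
  exacts [le_sup_left, le_sup_right]

theorem inf_add_eq_of_exists_add (hM : ∀ a b : M, a ≤ b ↔ ∃ c, b = a + c) (a b c : M) :
    (a ⊓ b) + c = (a + c) ⊓ (b + c) := by
  refine le_antisymm (le_inf (add_le_add_left inf_le_left c) (add_le_add_left inf_le_right c)) ?_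
  have hc : c ≤ (a + c) ⊓ (b + c) :=
    le_inf ((hM _ _).2 ⟨a, add_comm _ _⟩) ((hM _ _).2 ⟨b, add_comm _ _⟩)
  obtain ⟨d, hd⟩ := (hM _ _).1 hc
  rw [add_comm c d] at hd
  rw [hd, add_le_add_iff_right]
  refine le_inf ?_ ?_ <;> rw [← add_le_add_iff_right c, ← hd]
  exacts [inf_le_left, inf_le_right]

/-- Over a common subtrahend the join can be taken in `M`. Minimality against an arbitrary bound `d
- e` needs joins in `M` to commute with translation by `e`. -/
theorem grothendieck_exists_isLUB (hM : ∀ a b : M, a ≤ b ↔ ∃ c, b = a + c)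
    (x y : GrothendieckAddGroup M) : ∃ z, IsLUB {x, y} z := by
  obtain ⟨a, b, c, rfl, rfl⟩ := grothendieck_exists_sub_sub x y
  refine ⟨GrothendieckAddGroup.of (a ⊔ b) - GrothendieckAddGroup.of c, ?_, ?_⟩
  · rintro _ (rfl | rfl) <;> rw [grothendieck_sub_le_sub, add_le_add_iff_right]
    exacts [le_sup_left, le_sup_right]
  · intro z hz
    obtain ⟨d, e, rfl⟩ := grothendieck_exists_sub z
    have h1 := hz (Or.inl rfl)
    have h2 := hz (Or.inr rfl)
    rw [grothendieck_sub_le_sub] at h1 h2 ⊢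
    rw [sup_add_eq_of_exists_add hM]
    exact sup_le h1 h2

theorem grothendieck_exists_isGLB (hM : ∀ a b : M, a ≤ b ↔ ∃ c, b = a + c)
    (x y : GrothendieckAddGroup M) : ∃ z, IsGLB {x, y} z := by
  obtain ⟨a, b, c, rfl, rfl⟩ := grothendieck_exists_sub_sub x y
  refine ⟨GrothendieckAddGroup.of (a ⊓ b) - GrothendieckAddGroup.of c, ?_, ?_⟩
  · rintro _ (rfl | rfl) <;> rw [grothendieck_sub_le_sub, add_le_add_iff_right]
    exacts [inf_le_left, inf_le_right]
  · intro z hz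
    obtain ⟨d, e, rfl⟩ := grothendieck_exists_sub z
    have h1 := hz (Or.inl rfl)
    have h2 := hz (Or.inr rfl)
    rw [grothendieck_sub_le_sub] at h1 h2 ⊢
    rw [inf_add_eq_of_exists_add hM]
    exact le_inf h1 h2

/-- The lattice structure of the Grothendieck group of a cancellative, canonically ordered lattice
monoid. -/
@[reducible]
noncomputable def grothendieckLattice (hM : ∀ a b : M, a ≤ b ↔ ∃ c, b = a + c) :
    Lattice (GrothendieckAddGroup M) where
  -- Choosing the bounds, instead of defining them on representatives, leaves no well-definedness to
  -- check; they are unique anyway.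
  sup x y := (grothendieck_exists_isLUB hM x y).choose
  inf x y := (grothendieck_exists_isGLB hM x y).choose
  le_sup_left x y := (grothendieck_exists_isLUB hM x y).choose_spec.1 (Or.inl rfl)
  le_sup_right x y := (grothendieck_exists_isLUB hM x y).choose_spec.1 (Or.inr rfl)
  sup_le x y z hx hy := (grothendieck_exists_isLUB hM x y).choose_spec.2 <| by
    rintro _ (rfl | rfl)
    exacts [hx, hy]
  inf_le_left x y := (grothendieck_exists_isGLB hM x y).choose_spec.1 (Or.inl rfl)
  inf_le_right x y := (grothendieck_exists_isGLB hM x y).choose_spec.1 (Or.inr rfl)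
  le_inf x y z hx hy := (grothendieck_exists_isGLB hM y z).choose_spec.2 <| by
    rintro _ (rfl | rfl)
    exacts [hx, hy]

/-- The Grothendieck group of a cancellative, canonically ordered lattice monoid as an
`ℓ`-group. -/
noncomputable def grothendieckLGrp (hM : ∀ a b : M, a ≤ b ↔ ∃ c, b = a + c) : LGrp.{u} where
  carrier := GrothendieckAddGroup M
  addCommGroup := inferInstance
  lattice := grothendieckLattice hM
  isOrdered := inferInstanceAs (IsOrderedAddMonoid (GrothendieckAddGroup M))

/-- A cancellative, canonically ordered lattice monoid is the positive cone of an `ℓ`-group. -/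
theorem exists_lgrp_cone_addEquiv (hM : ∀ a b : M, a ≤ b ↔ ∃ c, b = a + c) :
    ∃ G : LGrp.{u}, Nonempty (M ≃+ {g : G.carrier // 0 ≤ g}) := by
  have h0 : ∀ a : M, (0 : GrothendieckAddGroup M) ≤ GrothendieckAddGroup.of a := fun a => by
    rw [← map_zero (GrothendieckAddGroup.of (M := M)), grothendieck_of_le_of, hM]
    exact ⟨a, (zero_add a).symm⟩
  let f : M →+ {g : (grothendieckLGrp hM).carrier // 0 ≤ g} :=
    { toFun := fun a => ⟨(GrothendieckAddGroup.of a : GrothendieckAddGroup M), h0 a⟩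
      map_zero' := Subtype.ext (map_zero (GrothendieckAddGroup.of (M := M)))
      map_add' := fun a b => Subtype.ext (map_add (GrothendieckAddGroup.of (M := M)) a b) }
  refine ⟨grothendieckLGrp hM, ⟨AddEquiv.ofBijective f ⟨?_, ?_⟩⟩⟩
  · intro a b h
    exact GrothendieckAddGroup.of_injective (congrArg Subtype.val h)
  · rintro ⟨x, hx⟩
    obtain ⟨a, c, rfl⟩ := grothendieck_exists_sub (M := M) x
    have hx' : (0 : GrothendieckAddGroup M) ≤
      GrothendieckAddGroup.of a - GrothendieckAddGroup.of c := hx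
    -- Nonnegativity of `a - c` means `c ≤ a`, hence `a = c + d`, and `d` is the preimage.
    rw [sub_nonneg, grothendieck_of_le_of, hM] at hx'
    obtain ⟨d, rfl⟩ := hx'
    refine ⟨d, Subtype.ext ?_⟩
    change (GrothendieckAddGroup.of d : GrothendieckAddGroup M) =
      GrothendieckAddGroup.of (c + d) - GrothendieckAddGroup.of c
    rw [map_add, add_sub_cancel_left]

end Grothendieck

/-! ### The radical as an ordered monoid -/

namespace MVAlgebra

variable {A : Type u} [MVAlgebra A]

/-- Equivalently `odot x y = 0`: the sum of two infinitesimals is not truncated. -/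
theorem le_compl_of_mem_rad {x y : A} (hx : x ∈ rad A) (hy : y ∈ rad A) : x ≤ yᶜ :=
  mv_le_compl_of_square (by simpa using hx 1 one_pos) (by simpa using hy 1 one_pos)

/-- The source of cancellation in the radical: the left side is always `xᶜ ⊓ y`, and here `y ≤ xᶜ`.
-/
theorem odot_compl_add_of_mem_rad {x y : A} (hx : x ∈ rad A) (hy : y ∈ rad A) :
    odot xᶜ (x + y) = y := by
  have h := mv_odot_compl_add xᶜ y
  rwa [mv_compl_compl, inf_eq_right.2 (le_compl_of_mem_rad hy hx)] at h

theorem odot_compl_mem_rad {x : A} (hx : x ∈ rad A) (y : A) : odot x yᶜ ∈ rad A :=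
  rad_of_le hx (mv_odot_le_left _ _)

theorem odot_compl_add_eq_sup (x y : A) : odot x yᶜ + y = x ⊔ y := by
  rw [odot, mv_compl_compl, mv_sup_def]

variable (A) in
/-- The radical as a submonoid. -/
def radSubmonoid : AddSubmonoid A where
  carrier := rad A
  zero_mem' := zero_mem_rad
  add_mem' := add_mem_rad

instance radLattice : Lattice (radSubmonoid A) :=
  Subtype.lattice (fun _ _ hx hy => rad_of_le (add_mem_rad hx hy) (mv_sup_le_add _ _))
    (fun _ _ hx _ => rad_of_le hx inf_le_left)

instance radIsOrderedCancelAddMonoid : IsOrderedCancelAddMonoid (radSubmonoid A) where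
  add_le_add_left _ _ h c := mv_add_le_add h (le_refl c.1)
  le_of_add_le_add_left a b c h := by
    have h2 : a.1 + b.1 ≤ a.1 + c.1 := h
    have h3 := mv_odot_mono (le_refl a.1ᶜ) h2
    rwa [odot_compl_add_of_mem_rad a.2 b.2, odot_compl_add_of_mem_rad a.2 c.2] at h3

/-- The order is inherited from `A`, whose witnesses range over all of `A`. The truncated difference
`odot b aᶜ` is a witness below `b`, hence infinitesimal. -/
theorem rad_le_iff_exists_add (a b : radSubmonoid A) : a ≤ b ↔ ∃ c, b = a + c := by
  constructor
  · rintro ⟨z, hz⟩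
    have hle : a.1 ≤ b.1 := ⟨z, hz⟩
    have h : b.1 = odot b.1 a.1ᶜ + a.1 := by rw [odot_compl_add_eq_sup, sup_eq_left.2 hle]
    exact ⟨⟨_, odot_compl_mem_rad b.2 a.1⟩, Subtype.ext (h.trans (add_comm _ _))⟩
  · rintro ⟨c, rfl⟩
    exact mv_le_add_right _ _

end MVAlgebra

/-! ### Isomorphisms with positive cones -/

/-- An isomorphism of monoids that reflects and preserves the order is an isomorphism of lattice
monoids with a top. -/
def LatMonTop.isoOfAddEquiv {S T : LatMonTop.{u}} (e : S.carrier ≃+ T.carrier)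
    (he : ∀ x y, e x ≤ e y ↔ x ≤ y) : S ≅ T :=
  let o : S.carrier ≃o T.carrier := ⟨e.toEquiv, fun {x y} => he x y⟩
  { hom :=
      { toFun := e
        map_zero := map_zero e
        map_add := map_add e
        map_inf := o.map_inf
        map_sup := o.map_sup
        map_top := o.map_top
        map_cone := fun _ hx h => hx (o.injective (h.trans o.map_top.symm)) }
    inv :=
      { toFun := e.symm
        map_zero := map_zero e.symm
        map_add := map_add e.symm
        map_inf := o.symm.map_inf
        map_sup := o.symm.map_sup
        map_top := o.symm.map_top
        map_cone := fun _ hx h => hx (o.symm.injective (h.trans o.symm.map_top.symm)) }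
    hom_inv_id := LatMonTopHom.ext (funext e.symm_apply_apply)
    inv_hom_id := LatMonTopHom.ext (funext e.apply_symm_apply) }

theorem cone_le_iff_exists_add {G : LGrp.{u}} (a b : {g : G.carrier // 0 ≤ g}) :
    a ≤ b ↔ ∃ c, b = a + c := by
  constructor
  · intro h
    exact ⟨⟨b.1 - a.1, sub_nonneg.2 h⟩, Subtype.ext (add_sub_cancel a.1 b.1).symm⟩
  · rintro ⟨c, rfl⟩
    exact le_add_of_nonneg_right (α := G.carrier) c.2

/-- A divisibility order is determined by addition, so between cones and radicals an additive
isomorphism already respects the order, and with it the lattice operations. -/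
theorem AddEquiv.le_iff_of_exists_add {M N : Type*} [Add M] [Add N] [LE M] [LE N]
    (hM : ∀ a b : M, a ≤ b ↔ ∃ c, b = a + c) (hN : ∀ a b : N, a ≤ b ↔ ∃ c, b = a + c)
    (e : M ≃+ N) (x y : M) : e x ≤ e y ↔ x ≤ y := by
  rw [hM, hN]
  constructor
  · rintro ⟨c, hc⟩
    exact ⟨e.symm c, e.injective (by rw [hc, map_add, e.apply_symm_apply])⟩
  · rintro ⟨c, rfl⟩
    exact ⟨e c, map_add e x c⟩

section ConeIso

variable {P : PERF.{u}} {G : LGrp.{u}}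

/-- The map from a positive cone with a top to `θ(P)` that extends a map to the radical. -/
def coneToTheta (e : {g : G.carrier // 0 ≤ g} ≃+ radSubmonoid P.obj.carrier) :
    (coneWithTop G).carrier → (thetaObj P).carrier :=
  WithTop.recTopCoe (C := fun _ => (thetaObj P).carrier) ⟨1, one_mem_theta⟩
    fun g => ⟨(e g).1, rad_subset_theta (e g).2⟩

/-- Injective because 1 is not infinitesimal, so the top stays apart from the cone; surjective
because `θ(P)` has no elements besides 1 and the infinitesimals. -/
theorem coneToTheta_bijective (e : {g : G.carrier // 0 ≤ g} ≃+ radSubmonoid P.obj.carrier) :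
    Function.Bijective (coneToTheta e) := by
  have h1 : ∀ g, (e g).1 ≠ 1 := fun g h => P.property.one_notMem_rad (h ▸ (e g).2)
  constructor
  · intro x y h
    induction x using WithTop.recTopCoe with
    | top =>
      induction y using WithTop.recTopCoe with
      | top => rfl
      | coe b => exact absurd (congrArg Subtype.val h).symm (h1 b)
    | coe a =>
      induction y using WithTop.recTopCoe with
      | top => exact absurd (congrArg Subtype.val h) (h1 a)
      | coe b =>
        have h2 : (e a).1 = (e b).1 :=
          congrArg (fun y : (thetaObj P).carrier => y.1) h
        exact congrArg _ (e.injective (Subtype.ext h2))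
  · rintro ⟨x, hx⟩
    rcases (P.property.mem_theta_iff x).1 hx with hr | rfl
    · refine ⟨((e.symm ⟨x, hr⟩ : {g : G.carrier // 0 ≤ g}) : WithTop _), Subtype.ext ?_⟩
      exact congrArg (fun y : radSubmonoid P.obj.carrier => y.1) (e.apply_symm_apply ⟨x, hr⟩)
    · exact ⟨(⊤ : WithTop _), rfl⟩

theorem coneToTheta_add (e : {g : G.carrier // 0 ≤ g} ≃+ radSubmonoid P.obj.carrier)
    (x y : (coneWithTop G).carrier) :
    coneToTheta e (x + y) = coneToTheta e x + coneToTheta e y := by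
  induction x using WithTop.recTopCoe with
  | top => exact Subtype.ext ((mv_add_one _).symm.trans (add_comm _ _))
  | coe a =>
    induction y using WithTop.recTopCoe with
    | top => exact Subtype.ext (mv_add_one _).symm
    | coe b =>
      refine Subtype.ext ?_
      exact congrArg (fun y : radSubmonoid P.obj.carrier => y.1) (map_add e a b)

theorem coneToTheta_le_iff (e : {g : G.carrier // 0 ≤ g} ≃+ radSubmonoid P.obj.carrier)
    (x y : (coneWithTop G).carrier) : coneToTheta e x ≤ coneToTheta e y ↔ x ≤ y := by
  have h1 : ∀ g, (e g).1 ≠ 1 := fun g h => P.property.one_notMem_rad (h ▸ (e g).2)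
  induction y using WithTop.recTopCoe with
  | top => exact iff_of_true (mv_le_one _) (le_top (α := (coneWithTop G).carrier))
  | coe b =>
    induction x using WithTop.recTopCoe with
    | top =>
      refine iff_of_false (fun h => h1 b (le_antisymm (mv_le_one _) h)) ?_
      exact WithTop.not_top_le_coe b
    | coe a =>
      refine Iff.trans ?_ (WithTop.coe_le_coe (a := b) (b := a)).symm
      exact e.le_iff_of_exists_add cone_le_iff_exists_add rad_le_iff_exists_add a b

/-- If the radical of `P` is isomorphic to the positive cone of `G`, then `θ(P)` is isomorphic to
that cone with a top. -/
noncomputable def coneIsoTheta (e : {g : G.carrier // 0 ≤ g} ≃+ radSubmonoid P.obj.carrier) :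
    coneWithTop G ≅ thetaObj P :=
  LatMonTop.isoOfAddEquiv
    (AddEquiv.ofBijective (AddHom.mk (coneToTheta e) (coneToTheta_add e)) (coneToTheta_bijective e))
    (coneToTheta_le_iff e)

end ConeIso

theorem isConeWithTop_theta (P : PERF.{u}) : IsConeWithTop.{u} (thetaFunctor.{u}.obj P) := by
  obtain ⟨G, ⟨e⟩⟩ := exists_lgrp_cone_addEquiv (rad_le_iff_exists_add (A := P.obj.carrier))
  exact ⟨G, ⟨(coneIsoTheta e.symm).symm⟩⟩

/-! ### The radical of `Δ(G)` -/

section DeltaRad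

variable {G : Type u} [AddCommGroup G] [Lattice G] [IsOrderedAddMonoid G]

/-- Otherwise the first coordinate is 1, so `xᶜ` has first coordinate 0 and is infinitesimal too;
then so is `xᶜ + x = 1`, which is impossible. -/
theorem delta_fst_eq_zero {x : DeltaCarrier G} (hx : x ∈ rad (DeltaCarrier G)) :
    (ofLex x.1).1 = 0 := by
  have h0 : 0 ≤ (ofLex x.1).1 := by
    rcases Prod.Lex.le_iff.1 x.2.1 with h | h
    · exact h.le
    · exact h.1.le
  by_contra hne
  have hr : xᶜ ∈ rad (DeltaCarrier G) := by
    have h1 : (ofLex x.1).1 ≤ 1 := by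
      rcases Prod.Lex.le_iff.1 x.2.2 with h | h
      · exact h.le
      · exact h.1.le
    refine delta_mem_rad ?_
    change (1 : ℤ) - (ofLex x.1).1 = 0
    omega
  have h := add_mem_rad hr hx
  rw [mv_compl_add_self] at h
  exact (delta_isPerfect G).one_notMem_rad h

/-- The element `(0, g)` of `Δ(G)`, for `g ≥ 0`. -/
def deltaOf (g : G) (hg : 0 ≤ g) : DeltaCarrier G :=
  ⟨toLex (0, g), Prod.Lex.le_iff.2 (Or.inr ⟨rfl, hg⟩), Prod.Lex.le_iff.2 (Or.inl zero_lt_one)⟩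

theorem deltaOf_mem_rad (g : G) (hg : 0 ≤ g) : deltaOf g hg ∈ rad (DeltaCarrier G) :=
  delta_mem_rad rfl

theorem snd_nonneg_of_mem_rad {x : DeltaCarrier G} (hx : x ∈ rad (DeltaCarrier G)) :
    0 ≤ (ofLex x.1).2 := by
  rcases Prod.Lex.le_iff.1 x.2.1 with h | h
  · exact absurd (delta_fst_eq_zero hx) h.ne'
  · exact h.2

theorem deltaOf_snd {x : DeltaCarrier G} (hx : x ∈ rad (DeltaCarrier G)) :
    deltaOf (ofLex x.1).2 (snd_nonneg_of_mem_rad hx) = x :=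
  Gamma.ext (congrArg toLex (Prod.ext (delta_fst_eq_zero hx).symm rfl))

theorem deltaOf_add (g h : G) (hg : 0 ≤ g) (hh : 0 ≤ h) :
    deltaOf (g + h) (add_nonneg hg hh) = deltaOf g hg + deltaOf h hh := by
  apply Gamma.ext
  rw [delta_add_val, inf_eq_left.2]
  · exact congrArg toLex (Prod.ext (add_zero (0 : ℤ)).symm rfl)
  · exact Prod.Lex.le_iff.2 (Or.inl (by change (0 : ℤ) + 0 < 1; norm_num))

/-- The order on `Δ(G)` is the natural MV-order, so the comparison goes through its witness `z`.
Being below `(0, h)`, `z` is infinitesimal and hence of the form `(0, k)` with `k ≥ 0`. -/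
theorem deltaOf_le_iff (g h : G) (hg : 0 ≤ g) (hh : 0 ≤ h) :
    deltaOf g hg ≤ deltaOf h hh ↔ g ≤ h := by
  constructor
  · rintro ⟨z, hz⟩
    have hzr : z ∈ rad (DeltaCarrier G) :=
      rad_of_le (deltaOf_mem_rad h hh) (hz ▸ mv_le_add_left _ _)
    rw [← deltaOf_snd hzr, ← deltaOf_add] at hz
    have h2 : h = g + (ofLex z.1).2 := congrArg (fun x : DeltaCarrier G => (ofLex x.1).2) hz
    rw [h2]
    exact le_add_of_nonneg_right (snd_nonneg_of_mem_rad hzr)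
  · intro hle
    refine ⟨deltaOf (h - g) (sub_nonneg.2 hle), ?_⟩
    rw [← deltaOf_add]
    exact Gamma.ext (congrArg toLex (Prod.ext rfl (add_sub_cancel g h).symm))

/-- The MV-join of two infinitesimals is infinitesimal, hence itself a value of `deltaOf`; the
universal property then transfers along `deltaOf_le_iff`. -/
theorem deltaOf_sup (g h : G) (hg : 0 ≤ g) (hh : 0 ≤ h) :
    deltaOf (g ⊔ h) (le_sup_of_le_left hg) = deltaOf g hg ⊔ deltaOf h hh := by
  apply le_antisymm
  · have hr : deltaOf g hg ⊔ deltaOf h hh ∈ rad (DeltaCarrier G) :=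
      rad_of_le (add_mem_rad (deltaOf_mem_rad g hg) (deltaOf_mem_rad h hh)) (mv_sup_le_add _ _)
    rw [← deltaOf_snd hr, deltaOf_le_iff]
    refine sup_le ?_ ?_ <;> rw [← deltaOf_le_iff _ _ ‹_› (snd_nonneg_of_mem_rad hr), deltaOf_snd hr]
    exacts [le_sup_left, le_sup_right]
  · exact sup_le ((deltaOf_le_iff _ _ _ _).2 le_sup_left) ((deltaOf_le_iff _ _ _ _).2 le_sup_right)

theorem deltaOf_inf (g h : G) (hg : 0 ≤ g) (hh : 0 ≤ h) :
    deltaOf (g ⊓ h) (le_inf hg hh) = deltaOf g hg ⊓ deltaOf h hh := by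
  apply le_antisymm
  · exact le_inf ((deltaOf_le_iff _ _ _ _).2 inf_le_left) ((deltaOf_le_iff _ _ _ _).2 inf_le_right)
  · have hr : deltaOf g hg ⊓ deltaOf h hh ∈ rad (DeltaCarrier G) :=
      rad_of_le (deltaOf_mem_rad g hg) inf_le_left
    rw [← deltaOf_snd hr, deltaOf_le_iff]
    refine le_inf ?_ ?_ <;> rw [← deltaOf_le_iff _ _ (snd_nonneg_of_mem_rad hr) ‹_›, deltaOf_snd hr]
    exacts [inf_le_left, inf_le_right]

variable (G) in
/-- The radical of `Δ(G)` is the positive cone of `G`. -/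
def deltaRadEquiv : {g : G // 0 ≤ g} ≃+ radSubmonoid (DeltaCarrier G) where
  toFun g := ⟨deltaOf g.1 g.2, deltaOf_mem_rad g.1 g.2⟩
  invFun x := ⟨(ofLex x.1.1).2, snd_nonneg_of_mem_rad x.2⟩
  left_inv _ := rfl
  right_inv x := Subtype.ext (deltaOf_snd x.2)
  map_add' g h := Subtype.ext (deltaOf_add g.1 h.1 g.2 h.2)

end DeltaRad

/-! ### `θ` is full and faithful -/

theorem MVHom.ext_of_rad {A B : Type u} [MVAlgebra A] [MVAlgebra B] (hA : IsPerfect A)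
    {f g : MVHom A B} (h : ∀ x ∈ rad A, f.toFun x = g.toFun x) : f = g := by
  refine MVHom.ext (funext fun x => ?_)
  rcases hA.mem_or x with hx | hx
  · exact h x hx
  · have h2 := h _ hx
    rw [f.map_compl, g.map_compl] at h2
    rw [← mv_compl_compl (f.toFun x), h2, mv_compl_compl]

instance thetaFunctor_faithful : thetaFunctor.{u}.Faithful where
  map_injective {P Q f g} h := by
    refine ObjectProperty.hom_ext _ (MVHom.ext_of_rad P.property fun x hx => ?_)
    have h2 := congrFun (congrArg LatMonTopHom.toFun h) ⟨x, rad_subset_theta hx⟩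
    exact congrArg Subtype.val h2

/-! ### Extending maps from the radical to a perfect MV-algebra -/

section Extension

variable {A B : Type u} [MVAlgebra A] [MVAlgebra B]

open Classical in
/-- The extension of a map from the radical by `f (¬ x) = ¬ f x`. -/
noncomputable def radExtend (p : A → B) (x : A) : B := if x ∈ rad A then p x else (p xᶜ)ᶜ

/-- Otherwise `xᶜ + x = 1` would be infinitesimal. This keeps the two cases of `radExtend` from
overlapping. -/
theorem compl_notMem_rad (hA : IsPerfect A) {x : A} (hx : x ∈ rad A) : xᶜ ∉ rad A := fun h => by
  have h2 := add_mem_rad h hx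
  rw [mv_compl_add_self] at h2
  exact hA.one_notMem_rad h2

theorem radExtend_of_mem {p : A → B} {x : A} (hx : x ∈ rad A) : radExtend p x = p x := if_pos hx

theorem radExtend_compl_of_mem (hA : IsPerfect A) {p : A → B} {x : A} (hx : x ∈ rad A) :
    radExtend p xᶜ = (p x)ᶜ := by
  rw [radExtend, if_neg (compl_notMem_rad hA hx), mv_compl_compl]

/-- A map of radicals that preserves `⊕`, `0` and `∨` extends to a homomorphism of a perfect
MV-algebra. -/
noncomputable def MVHom.ofRad (hA : IsPerfect A) (p : A → B) (hp : ∀ x ∈ rad A, p x ∈ rad B)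
    (h0 : p 0 = 0) (hadd : ∀ x ∈ rad A, ∀ y ∈ rad A, p (x + y) = p x + p y)
    (hsup : ∀ x ∈ rad A, ∀ y ∈ rad A, p (x ⊔ y) = p x ⊔ p y) : MVHom A B :=
  have hc : ∀ x, radExtend p xᶜ = (radExtend p x)ᶜ := fun x => by
    rcases hA.mem_or x with hx | hx
    · rw [radExtend_compl_of_mem hA hx, radExtend_of_mem hx]
    · obtain ⟨y, rfl⟩ : ∃ y, x = yᶜ := ⟨xᶜ, (mv_compl_compl x).symm⟩
      rw [mv_compl_compl] at hx ⊢
      rw [radExtend_compl_of_mem hA hx, radExtend_of_mem hx, mv_compl_compl]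
  have hz : radExtend p 0 = 0 := (radExtend_of_mem zero_mem_rad).trans h0
  have h1 : radExtend p 1 = 1 := by rw [← mv_compl_zero, hc, hz, mv_compl_zero]
  -- Adding `p y` turns both sides into `p x ⊔ p y`; everything is infinitesimal, so `p y` cancels.
  -- This is where preservation of joins is used.
  have hsub : ∀ x ∈ rad A, ∀ y ∈ rad A, p (odot x yᶜ) = odot (p x) (p y)ᶜ := fun x hx y hy => by
    have hd := odot_compl_mem_rad hx y
    have h2 : p y + p (odot x yᶜ) = p y + odot (p x) (p y)ᶜ := by
      rw [add_comm, add_comm (p y), ← hadd _ hd _ hy, odot_compl_add_eq_sup,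
        odot_compl_add_eq_sup, hsup x hx y hy]
    have h3 := congrArg (odot (p y)ᶜ) h2
    rwa [odot_compl_add_of_mem_rad (hp y hy) (hp _ hd),
      odot_compl_add_of_mem_rad (hp y hy) (odot_compl_mem_rad (hp x hx) _)] at h3
  -- A mixed sum is the complement of a truncated difference of infinitesimals.
  have hmix : ∀ x ∈ rad A, ∀ y ∈ rad A, radExtend p (xᶜ + y) = (p x)ᶜ + p y := fun x hx y hy => by
    have h2 : xᶜ + y = (odot x yᶜ)ᶜ := by simp only [odot, mv_compl_compl]
    rw [h2, radExtend_compl_of_mem hA (odot_compl_mem_rad hx y), hsub x hx y hy]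
    simp only [odot, mv_compl_compl]
  { toFun := radExtend p
    map_zero := hz
    map_one := h1
    map_compl := hc
    map_add := fun x y => by
      rcases hA.mem_or x with hx | hx
      · rcases hA.mem_or y with hy | hy
        · rw [radExtend_of_mem hx, radExtend_of_mem hy, radExtend_of_mem (add_mem_rad hx hy),
            hadd x hx y hy]
        · have h2 := hmix _ hy _ hx
          rw [← radExtend_compl_of_mem hA hy, mv_compl_compl] at h2
          rw [add_comm, h2, radExtend_of_mem hx, add_comm]
      · have hx2 := radExtend_compl_of_mem hA (p := p) hx
        rw [mv_compl_compl] at hx2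
        rcases hA.mem_or y with hy | hy
        · have h2 := hmix _ hx _ hy
          rw [mv_compl_compl] at h2
          rw [h2, hx2, radExtend_of_mem hy]
        · have hy2 := radExtend_compl_of_mem hA (p := p) hy
          rw [mv_compl_compl] at hy2
          -- Two complements of infinitesimals add up to 1, in the source and in the target alike.
          have h3 := mv_le_iff.1 (le_compl_of_mem_rad hx hy)
          have h4 := mv_le_iff.1 (le_compl_of_mem_rad (hp _ hx) (hp _ hy))
          rw [mv_compl_compl, mv_compl_compl] at h3
          rw [h3, h1, hx2, hy2, h4] }

end Extension

instance thetaFunctor_full : thetaFunctor.{u}.Full where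
  map_surjective {P Q} φ := by
    classical
    let φ' : LatMonTopHom (thetaObj P).carrier (thetaObj Q).carrier := φ
    let p : P.obj.carrier → Q.obj.carrier := fun x =>
      if h : x ∈ theta P.obj.carrier then (φ'.toFun ⟨x, h⟩).1 else 0
    have hpe : ∀ x (h : x ∈ theta P.obj.carrier), p x = (φ'.toFun ⟨x, h⟩).1 := fun x h => dif_pos h
    have hp : ∀ x ∈ rad P.obj.carrier, p x ∈ rad Q.obj.carrier := fun x hx => by
      rw [hpe x (rad_subset_theta hx)]
      -- The image is infinitesimal or 1, and the cone condition on morphisms excludes 1.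
      refine ((Q.property.mem_theta_iff _).1 (φ'.toFun ⟨x, _⟩).2).resolve_right fun h => ?_
      refine φ'.map_cone ⟨x, rad_subset_theta hx⟩ (fun h2 => ?_) (Subtype.ext h)
      have h3 : x = 1 := congrArg Subtype.val h2
      exact P.property.one_notMem_rad (h3 ▸ hx)
    have h0 : p 0 = 0 :=
      (hpe 0 (rad_subset_theta zero_mem_rad)).trans (congrArg Subtype.val φ'.map_zero)
    have hadd : ∀ x ∈ rad P.obj.carrier, ∀ y ∈ rad P.obj.carrier, p (x + y) = p x + p y :=
      fun x hx y hy => by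
        have hx' := rad_subset_theta hx
        have hy' := rad_subset_theta hy
        rw [hpe x hx', hpe y hy', hpe (x + y) (P.property.add_mem_theta hx' hy')]
        exact congrArg Subtype.val (φ'.map_add ⟨x, hx'⟩ ⟨y, hy'⟩)
    have hsup : ∀ x ∈ rad P.obj.carrier, ∀ y ∈ rad P.obj.carrier, p (x ⊔ y) = p x ⊔ p y :=
      fun x hx y hy => by
        have hx' := rad_subset_theta hx
        have hy' := rad_subset_theta hy
        rw [hpe x hx', hpe y hy', hpe (x ⊔ y) (P.property.sup_mem_theta hx' hy')]
        exact congrArg Subtype.val (φ'.map_sup ⟨x, hx'⟩ ⟨y, hy'⟩)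
    let f := MVHom.ofRad P.property p hp h0 hadd hsup
    refine ⟨ObjectProperty.homMk f, LatMonTopHom.ext (funext fun x => Subtype.ext ?_)⟩
    change f.toFun x.1 = (φ'.toFun x).1
    rcases (P.property.mem_theta_iff x.1).1 x.2 with hr | h1
    · exact (radExtend_of_mem hr).trans (hpe x.1 x.2)
    · have hx : x = (⊤ : (thetaObj P).carrier) := Subtype.ext h1
      rw [h1, f.map_one, hx]
      exact (congrArg Subtype.val φ'.map_top).symm

/-! ### `Δ` is full and faithful -/

theorem deltaOf_injective {G : Type u} [AddCommGroup G] [Lattice G] {g h : G} {hg : 0 ≤ g}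
    {hh : 0 ≤ h} (e : deltaOf g hg = deltaOf h hh) : g = h :=
  congrArg (fun x : DeltaCarrier G => (ofLex x.1).2) e

theorem LGrpHom.ext_of_nonneg {G H : Type u} [AddCommGroup G] [Lattice G]
    [IsOrderedAddMonoid G] [AddCommGroup H] [Lattice H] {f g : LGrpHom G H}
    (h : ∀ x, 0 ≤ x → f.toFun x = g.toFun x) : f = g := by
  refine LGrpHom.ext (funext fun x => ?_)
  rw [← posPart_sub_negPart x, f.map_sub, g.map_sub, h _ (posPart_nonneg x),
    h _ (negPart_nonneg x)]

/-! ### Extending maps from the positive cone to the `ℓ`-group -/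

section ConeExtension

variable {G H : Type u} [AddCommGroup G] [Lattice G] [IsOrderedAddMonoid G]
  [AddCommGroup H] [Lattice H] [IsOrderedAddMonoid H]

theorem exists_nonneg_sub_sub (x y : G) :
    ∃ a b c : G, 0 ≤ a ∧ 0 ≤ b ∧ 0 ≤ c ∧ x = a - c ∧ y = b - c := by
  refine ⟨x⁺ + y⁻, y⁺ + x⁻, x⁻ + y⁻, add_nonneg (posPart_nonneg _) (negPart_nonneg _),
    add_nonneg (posPart_nonneg _) (negPart_nonneg _),
    add_nonneg (negPart_nonneg _) (negPart_nonneg _), ?_, ?_⟩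
  · rw [add_sub_add_right_eq_sub, posPart_sub_negPart]
  · rw [add_comm x⁻, add_sub_add_right_eq_sub, posPart_sub_negPart]

/-- A map of positive cones that preserves `+`, `∧` and `∨` extends to a homomorphism of
`ℓ`-groups. -/
def LGrpHom.ofCone (p : G → H) (hadd : ∀ x y, 0 ≤ x → 0 ≤ y → p (x + y) = p x + p y)
    (hinf : ∀ x y, 0 ≤ x → 0 ≤ y → p (x ⊓ y) = p x ⊓ p y)
    (hsup : ∀ x y, 0 ≤ x → 0 ≤ y → p (x ⊔ y) = p x ⊔ p y) : LGrpHom G H :=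
  -- Any difference of positive elements may replace `x⁺ - x⁻`. With a common subtrahend, `∧` and
  -- `∨` in `G` then reduce to those of the cone.
  have key : ∀ a c, 0 ≤ a → 0 ≤ c → p (a - c)⁺ - p (a - c)⁻ = p a - p c := fun a c ha hc => by
    have h : (a - c)⁺ + c = a + (a - c)⁻ := by
      have h2 := posPart_sub_negPart (a - c)
      rw [sub_eq_sub_iff_add_eq_add] at h2
      exact h2
    rw [sub_eq_sub_iff_add_eq_add, ← hadd _ _ (posPart_nonneg _) hc,
      ← hadd _ _ ha (negPart_nonneg _), h]
  { toFun := fun x => p x⁺ - p x⁻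
    map_add := fun x y => by
      obtain ⟨a, b, c, ha, hb, hc, rfl, rfl⟩ := exists_nonneg_sub_sub x y
      rw [sub_add_sub_comm, key _ _ (add_nonneg ha hb) (add_nonneg hc hc), key a c ha hc,
        key b c hb hc, hadd a b ha hb, hadd c c hc hc, sub_add_sub_comm]
    map_inf := fun x y => by
      obtain ⟨a, b, c, ha, hb, hc, rfl, rfl⟩ := exists_nonneg_sub_sub x y
      rw [← inf_sub, key _ _ (le_inf ha hb) hc, key a c ha hc, key b c hb hc, hinf a b ha hb,
        inf_sub]
    map_sup := fun x y => by
      obtain ⟨a, b, c, ha, hb, hc, rfl, rfl⟩ := exists_nonneg_sub_sub x y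
      rw [← sup_sub, key _ _ (le_sup_of_le_left ha) hc, key a c ha hc, key b c hb hc,
        hsup a b ha hb, sup_sub] }

theorem LGrpHom.ofCone_apply {p : G → H} {hadd hinf hsup} {x : G} (hx : 0 ≤ x) :
    (LGrpHom.ofCone p hadd hinf hsup).toFun x = p x := by
  have h0 : p 0 = 0 := by
    have h := hadd 0 0 le_rfl le_rfl
    rw [add_zero] at h
    exact left_eq_add.1 h
  change p x⁺ - p x⁻ = p x
  rw [posPart_of_nonneg hx, negPart_of_nonneg hx, h0, sub_zero]

/-- A homomorphism `Δ(G) → Δ(H)` restricted to the positive cones of `G` and `H`; on other elements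
it takes the value at the positive part. -/
def coneRestrict (ψ : MVHom (DeltaCarrier G) (DeltaCarrier H)) (g : G) : H :=
  (ofLex (ψ.toFun (deltaOf g⁺ (posPart_nonneg g))).1).2

theorem coneRestrict_nonneg (ψ : MVHom (DeltaCarrier G) (DeltaCarrier H)) (g : G) :
    0 ≤ coneRestrict ψ g :=
  snd_nonneg_of_mem_rad (ψ.map_rad (deltaOf_mem_rad _ _))

/-- Since `deltaOf` is injective, this turns identities for `coneRestrict ψ` into identities for
`ψ`. -/
theorem deltaOf_coneRestrict (ψ : MVHom (DeltaCarrier G) (DeltaCarrier H)) {g : G} (hg : 0 ≤ g) :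
    deltaOf (coneRestrict ψ g) (coneRestrict_nonneg ψ g) = ψ.toFun (deltaOf g hg) := by
  refine (deltaOf_snd (ψ.map_rad (deltaOf_mem_rad _ _))).trans ?_
  congr 2
  exact posPart_of_nonneg hg

/-- The homomorphism of `ℓ`-groups underlying a homomorphism `Δ(G) → Δ(H)`. -/
def LGrpHom.ofDelta (ψ : MVHom (DeltaCarrier G) (DeltaCarrier H)) : LGrpHom G H :=
  LGrpHom.ofCone (coneRestrict ψ)
    (fun x y hx hy => deltaOf_injective (hg := coneRestrict_nonneg ψ _)
      (hh := add_nonneg (coneRestrict_nonneg ψ _) (coneRestrict_nonneg ψ _)) <| by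
        rw [deltaOf_add _ _ (coneRestrict_nonneg ψ _) (coneRestrict_nonneg ψ _),
          deltaOf_coneRestrict ψ (add_nonneg hx hy), deltaOf_coneRestrict ψ hx,
          deltaOf_coneRestrict ψ hy, deltaOf_add, ψ.map_add])
    (fun x y hx hy => deltaOf_injective (hg := coneRestrict_nonneg ψ _)
      (hh := le_inf (coneRestrict_nonneg ψ _) (coneRestrict_nonneg ψ _)) <| by
        rw [deltaOf_inf _ _ (coneRestrict_nonneg ψ _) (coneRestrict_nonneg ψ _),
          deltaOf_coneRestrict ψ (le_inf hx hy), deltaOf_coneRestrict ψ hx,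
          deltaOf_coneRestrict ψ hy, deltaOf_inf, ψ.map_inf])
    (fun x y hx hy => deltaOf_injective (hg := coneRestrict_nonneg ψ _)
      (hh := le_sup_of_le_left (coneRestrict_nonneg ψ _)) <| by
        rw [deltaOf_sup _ _ (coneRestrict_nonneg ψ _) (coneRestrict_nonneg ψ _),
          deltaOf_coneRestrict ψ (le_sup_of_le_left hx), deltaOf_coneRestrict ψ hx,
          deltaOf_coneRestrict ψ hy, deltaOf_sup _ _ hx hy, ψ.map_sup])

theorem deltaMap_deltaOf (f : LGrpHom G H) {g : G} (hg : 0 ≤ g) :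
    (deltaMap f).toFun (deltaOf g hg) = deltaOf (f.toFun g) (f.map_zero ▸ f.map_le hg) := rfl

/-- Both sides agree on the elements `(0, g)`, which exhaust the radical, and `Δ(G)` is perfect. -/
theorem deltaMap_ofDelta (ψ : MVHom (DeltaCarrier G) (DeltaCarrier H)) :
    deltaMap (LGrpHom.ofDelta ψ) = ψ := by
  refine MVHom.ext_of_rad (delta_isPerfect G) fun x hx => ?_
  have hx0 := snd_nonneg_of_mem_rad hx
  rw [← deltaOf_snd hx, deltaMap_deltaOf, ← deltaOf_coneRestrict ψ hx0]
  congr 1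
  exact LGrpHom.ofCone_apply hx0

end ConeExtension

instance Delta_faithful : Delta.{u}.Faithful where
  map_injective {G H f g} h := by
    refine LGrpHom.ext_of_nonneg fun x hx => ?_
    have h2 : deltaMap f = deltaMap g := congrArg (fun k => k.hom) h
    have h3 := congrFun (congrArg MVHom.toFun h2) (deltaOf x hx)
    rw [deltaMap_deltaOf, deltaMap_deltaOf] at h3
    exact deltaOf_injective h3

instance Delta_full : Delta.{u}.Full where
  map_surjective ψ := ⟨LGrpHom.ofDelta ψ.hom, ObjectProperty.hom_ext _ (deltaMap_ofDelta ψ.hom)⟩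

/-! ### The equivalences -/

/-- `θ(Δ(G))` is the positive cone of `G` with a top. -/
noncomputable def coneIsoThetaDelta (G : LGrp.{u}) :
    coneWithTop G ≅ thetaFunctor.obj (Delta.obj G) :=
  coneIsoTheta (P := Delta.obj G) (deltaRadEquiv G.carrier)

theorem delta_comp_theta_essSurj (h : ∀ P : PERF.{u}, IsConeWithTop.{u} (thetaFunctor.{u}.obj P)) :
    (Delta.{u} ⋙ IsConeWithTop.{u}.lift thetaFunctor.{u} h).EssSurj where
  mem_essImage S := by
    obtain ⟨G, ⟨i⟩⟩ := S.property
    exact ⟨G, ⟨ObjectProperty.isoMk _ (i ≪≫ coneIsoThetaDelta G).symm⟩⟩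

theorem mainTheorem2 :
    (∀ P : PERF.{u}, theta P.obj.carrier = rad P.obj.carrier ∪ {1}) ∧
    ∃ h : ∀ P : PERF.{u}, IsConeWithTop.{u} (thetaFunctor.{u}.obj P),
      (IsConeWithTop.{u}.lift thetaFunctor.{u} h : PERF.{u} ⥤ TOP.{u}).IsEquivalence ∧
      (Delta.{u} ⋙ IsConeWithTop.{u}.lift thetaFunctor.{u} h : LGrp.{u} ⥤ TOP.{u}).IsEquivalence := by
  refine ⟨fun P => Set.ext fun x => P.property.mem_theta_iff x, isConeWithTop_theta, ?_⟩
  have hD := delta_comp_theta_essSurj isConeWithTop_theta.{u}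
  -- A preimage `G` under the composite gives the preimage `Δ(G)` under `θ`.
  have hT : (IsConeWithTop.{u}.lift thetaFunctor.{u} isConeWithTop_theta).EssSurj :=
    ⟨fun S => by
      obtain ⟨G, ⟨i⟩⟩ := hD.mem_essImage S
      exact ⟨Delta.obj G, ⟨i⟩⟩⟩
  -- Fullness and faithfulness, also of the composite, come from the instances for `θ` and `Δ`.
  exact ⟨{}, {}⟩
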